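/- Proposition 4.1 (helicoidal examples). Consider $\mathbb{H}^2\times\mathbb{R}=\{(x,y,z)\in\mathbb{R}^3 : x^2+y^2<1\}$ with the product metric $\frac{4(dx^2+dy^2)}{(1-x^2-y^2)^2}+dz^2$, and let $\pi(x,y,z)=(x,y)$ be the projection to the disk $\mathbb{H}^2$. For $t\in\mathbb{R}$ let $$F_t(x,y,z)=\left(1+\frac{4(x-1)}{4+4ty+t^2((x-1)^2+y^2)},\ \frac{4y+2t((x-1)^2+y^2)}{4+4ty+t^2((x-1)^2+y^2)},\ z\right)$$ be the one-parameter group of parabolic isometries fixing the point $(1,0)$ at infinity, and let $\psi(x,y)=\left(\frac{e^x-1}{e^x+1},0,y\right)$ be the isometric parametrization of the vertical plane $\{y=0\}$. Let $-\infty\le y_1<y_2\le+\infty$ and let $\rho:(y_1,y_2)\to\mathbb{R}$ be twice differentiable with $\rho''(y)>0$ for all $y\in(y_1,y_2)$ and $\lim_{y\to y_1}\rho(y)=\lim_{y\to y_2}\rho(y)=+\infty$. Let $S_\rho$ be the surface parametrized by $f_\rho(y,t)=F_t(\psi(\rho(y),y))$, $(y,t)\in(y_1,y_2)\times\mathbb{R}$.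 Then $S_\rho$ is a properly embedded surface: $f_\rho$ is a $C^1$, twice differentiable immersion that is a homeomorphism onto its image and a proper map into $\mathbb{H}^2\times\mathbb{R}$; moreover $f_\rho$ is of class $C^n$ whenever $\rho$ is. At the point $f_\rho(y,t)$ its extrinsic curvature $K=\det(II)/\det(I)$, where $I$ and $II$ are the first and second fundamental forms, is $$K=\frac{\rho''(y)}{(1+\rho'(y)^2)^2},$$ and thus $K>0$. Finally, $S_\rho$ has a simple end. This means that there is a point $\theta_0$ of the unit circle such that the closure of $\pi(S_\rho)$ in the closed unit disk meets the unit circle exactly in $\theta_0$, and such that, for all distinct points $\theta_1,\theta_2\ne\theta_0$ of the unit circle, the vertical plane $\gamma(\theta_1,\theta_2)\times\mathbb{R}$ over the complete geodesic $\gamma(\theta_1,\theta_2)$ of $\mathbb{H}^2$ with endpoints $\theta_1,\theta_2$ meets $S_\rho$ in an empty or compact set. -/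

import Mathlib

open Set Filter Topology

noncomputable section

namespace H2xR

/-! ### Differential geometry in a global chart of a Riemannian 3-manifold

The metric is a matrix-valued function `g` on `ℝ³`; only its values on the open set where the
manifold lives matter.  A parametrized surface is a map `f` from (an open set of) `ℝ²` to `ℝ³`. -/

/-- The inner product `⟨v, w⟩` at the point `p` of the metric with coefficient matrix `g`. -/
def metricInner (g : (Fin 3 → ℝ) → Matrix (Fin 3) (Fin 3) ℝ) (p v w : Fin 3 → ℝ) : ℝ :=
  v ⬝ᵥ (g p).mulVec w

/-- The partial derivative `∂ᵢ u` at `p`. -/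
def partialDeriv {m : ℕ} {E : Type*} [NormedAddCommGroup E] [NormedSpace ℝ E]
    (i : Fin m) (u : (Fin m → ℝ) → E) (p : Fin m → ℝ) : E :=
  fderiv ℝ u p (Pi.single i 1)

/-- The Christoffel symbols
`Γᵏᵢⱼ = (1/2) ∑ₗ gᵏˡ (∂ᵢ gⱼₗ + ∂ⱼ gᵢₗ - ∂ₗ gᵢⱼ)` of the Levi-Civita connection. -/
def christoffel (g : (Fin 3 → ℝ) → Matrix (Fin 3) (Fin 3) ℝ) (p : Fin 3 → ℝ)
    (k i j : Fin 3) : ℝ :=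
  (1 / 2) * ∑ l, (g p)⁻¹ k l *
    (partialDeriv i (fun q => g q j l) p + partialDeriv j (fun q => g q i l) p
      - partialDeriv l (fun q => g q i j) p)

/-- The ambient covariant derivative `∇_{∂ₐf} ∂_b f` of the coordinate field `∂_b f` in the
direction `∂ₐ f`:
`(∇_{∂ₐf} ∂_b f)ᵏ = ∂ₐ ∂_b fᵏ + ∑ᵢⱼ Γᵏᵢⱼ(f) ∂ₐfⁱ ∂_b fʲ`. -/
def covDeriv (g : (Fin 3 → ℝ) → Matrix (Fin 3) (Fin 3) ℝ) (f : (Fin 2 → ℝ) → (Fin 3 → ℝ))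
    (a b : Fin 2) (q : Fin 2 → ℝ) : Fin 3 → ℝ :=
  fun k => partialDeriv a (partialDeriv b f) q k
    + ∑ i, ∑ j, christoffel g (f q) k i j * partialDeriv a f q i * partialDeriv b f q j

/-- The unit normal of `f` at `q`.  The covector `∂₀f × ∂₁f` annihilates the tangent plane;
raising its index gives a `g`-normal vector, which is then normalized. -/
def unitNormal (g : (Fin 3 → ℝ) → Matrix (Fin 3) (Fin 3) ℝ) (f : (Fin 2 → ℝ) → (Fin 3 → ℝ))
    (q : Fin 2 → ℝ) : Fin 3 → ℝ :=
  let ν : Fin 3 → ℝ := ((g (f q))⁻¹).mulVec (crossProduct (partialDeriv 0 f q) (partialDeriv 1 f q))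
  (Real.sqrt (metricInner g (f q) ν ν))⁻¹ • ν

/-- The matrix of the first fundamental form `I`. -/
def firstForm (g : (Fin 3 → ℝ) → Matrix (Fin 3) (Fin 3) ℝ) (f : (Fin 2 → ℝ) → (Fin 3 → ℝ))
    (q : Fin 2 → ℝ) : Matrix (Fin 2) (Fin 2) ℝ :=
  Matrix.of fun a b => metricInner g (f q) (partialDeriv a f q) (partialDeriv b f q)

/-- The matrix of the second fundamental form `II`. -/
def secondForm (g : (Fin 3 → ℝ) → Matrix (Fin 3) (Fin 3) ℝ) (f : (Fin 2 → ℝ) → (Fin 3 → ℝ))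
    (q : Fin 2 → ℝ) : Matrix (Fin 2) (Fin 2) ℝ :=
  Matrix.of fun a b => metricInner g (f q) (covDeriv g f a b q) (unitNormal g f q)

/-- The extrinsic curvature `K = det II / det I` of the parametrized surface `f` at `q`. -/
def extrinsicCurvature (g : (Fin 3 → ℝ) → Matrix (Fin 3) (Fin 3) ℝ)
    (f : (Fin 2 → ℝ) → (Fin 3 → ℝ)) (q : Fin 2 → ℝ) : ℝ :=
  (secondForm g f q).det / (firstForm g f q).det

/-! ### The space `ℍ² × ℝ` in the Poincaré disk model -/

/-- The unit disk, which carries the hyperbolic plane. -/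
def disk : Set (Fin 2 → ℝ) := {z | z 0 ^ 2 + z 1 ^ 2 < 1}

/-- The boundary at infinity of the hyperbolic plane: the unit circle. -/
def circleAtInfinity : Set (Fin 2 → ℝ) := {z | z 0 ^ 2 + z 1 ^ 2 = 1}

/-- The domain `{(x, y, t) | x² + y² < 1}` of `ℝ³`, which carries `ℍ² × ℝ`. -/
def space : Set (Fin 3 → ℝ) := {p | p 0 ^ 2 + p 1 ^ 2 < 1}

/-- The product metric `4 (dx² + dy²) / (1 - x² - y²)² + dt²`. -/
def metric (p : Fin 3 → ℝ) : Matrix (Fin 3) (Fin 3) ℝ :=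
  Matrix.diagonal ![4 / (1 - (p 0 ^ 2 + p 1 ^ 2)) ^ 2, 4 / (1 - (p 0 ^ 2 + p 1 ^ 2)) ^ 2, 1]

/-- The projection `π : ℍ² × ℝ → ℍ²`. -/
def proj (p : Fin 3 → ℝ) : Fin 2 → ℝ := ![p 0, p 1]

/-- The asymptotic boundary of a subset of the disk. -/
def asymptoticBoundary (Ω : Set (Fin 2 → ℝ)) : Set (Fin 2 → ℝ) :=
  closure Ω ∩ circleAtInfinity

/-- The point `p` lies on the Euclidean circle with centre `c` that is orthogonal to the unit
circle (so its radius `r` satisfies `r² = |c|² - 1`). -/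
def OnOrthogonalCircle (c p : Fin 2 → ℝ) : Prop :=
  (p 0 - c 0) ^ 2 + (p 1 - c 1) ^ 2 = (c 0 ^ 2 + c 1 ^ 2) - 1

/-- The point `p` lies on the straight line through the origin with normal vector `v`. -/
def OnDiameter (v p : Fin 2 → ℝ) : Prop := v 0 * p 0 + v 1 * p 1 = 0

/-- The complete geodesic of `ℍ²` with the (distinct) endpoints `θ₁, θ₂` at infinity, as a set:
the part inside the disk of the circle or straight line through `θ₁` and `θ₂` that is orthogonal
to the unit circle. -/
def geodesic (θ₁ θ₂ : Fin 2 → ℝ) : Set (Fin 2 → ℝ) :=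
  {z | z ∈ disk ∧
    ((∃ c, OnOrthogonalCircle c θ₁ ∧ OnOrthogonalCircle c θ₂ ∧ OnOrthogonalCircle c z) ∨
      (∃ v, v ≠ 0 ∧ OnDiameter v θ₁ ∧ OnDiameter v θ₂ ∧ OnDiameter v z))}

/-- The vertical plane `γ(θ₁, θ₂) × ℝ`. -/
def verticalPlane (θ₁ θ₂ : Fin 2 → ℝ) : Set (Fin 3 → ℝ) := {p | proj p ∈ geodesic θ₁ θ₂}

/-- `S` has a simple end: `π(S)` has exactly one point `θ₀` at infinity, and every vertical plane
over a geodesic with endpoints different from `θ₀` meets `S` in an empty or compact set. -/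
def HasSimpleEnd (S : Set (Fin 3 → ℝ)) : Prop :=
  ∃ θ₀ ∈ circleAtInfinity, asymptoticBoundary (proj '' S) = {θ₀} ∧
    ∀ θ₁ ∈ circleAtInfinity \ {θ₀}, ∀ θ₂ ∈ circleAtInfinity \ {θ₀}, θ₁ ≠ θ₂ →
      verticalPlane θ₁ θ₂ ∩ S = ∅ ∨ IsCompact (verticalPlane θ₁ θ₂ ∩ S)

/-- The parametrization `f : U → ℍ² × ℝ` of a surface is a proper embedding: it is a `C¹`
immersion, it is twice differentiable (so that the second fundamental form makes sense), it is a
homeomorphism onto its image, and it is a proper map into `ℍ² × ℝ`. -/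
structure IsProperlyEmbedded (U : Set (Fin 2 → ℝ)) (f : (Fin 2 → ℝ) → (Fin 3 → ℝ)) : Prop where
  contDiffOn : ContDiffOn ℝ 1 f U
  twiceDifferentiable : ∀ a, DifferentiableOn ℝ (partialDeriv a f) U
  immersion : ∀ q ∈ U, Function.Injective (fderiv ℝ f q)
  proper_embedding : ∃ h : MapsTo f U space, IsEmbedding h.restrict ∧ IsProperMap h.restrict

/-! ### The surfaces `S_ρ` -/

/-- The denominator `4 + 4ty + t²((x-1)² + y²)` of the parabolic isometry `F_t`. -/
def parabolicDenom (t : ℝ) (p : Fin 3 → ℝ) : ℝ :=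
  4 + 4 * t * p 1 + t ^ 2 * ((p 0 - 1) ^ 2 + p 1 ^ 2)

/-- The one-parameter group `F_t` of parabolic isometries of `ℍ² × ℝ` that fix the point
`(1, 0)` at infinity. -/
def parabolic (t : ℝ) (p : Fin 3 → ℝ) : Fin 3 → ℝ :=
  ![1 + 4 * (p 0 - 1) / parabolicDenom t p,
    (4 * p 1 + 2 * t * ((p 0 - 1) ^ 2 + p 1 ^ 2)) / parabolicDenom t p,
    p 2]

/-- The isometric parametrization `ψ(x, y) = ((eˣ - 1)/(eˣ + 1), 0, y)` of the vertical plane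
over the horizontal diameter. -/
def planeParam (x y : ℝ) : Fin 3 → ℝ := ![(Real.exp x - 1) / (Real.exp x + 1), 0, y]

/-- The parametrization `f_ρ(y, t) = F_t(ψ(ρ(y), y))`, with `y = q 0` and `t = q 1`. -/
def surfaceParam (ρ : ℝ → ℝ) (q : Fin 2 → ℝ) : Fin 3 → ℝ :=
  parabolic (q 1) (planeParam (ρ (q 0)) (q 0))

/-- The open interval `(y₁, y₂)` of real numbers, with possibly infinite endpoints. -/
def openInterval (y₁ y₂ : EReal) : Set ℝ := {y | y₁ < (y : EReal) ∧ (y : EReal) < y₂}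

/-- The parameter domain `(y₁, y₂) × ℝ`. -/
def strip (y₁ y₂ : EReal) : Set (Fin 2 → ℝ) := {q | q 0 ∈ openInterval y₁ y₂}

/-- The surface `S_ρ` as a subset of `ℍ² × ℝ`. -/
def surface (y₁ y₂ : EReal) (ρ : ℝ → ℝ) : Set (Fin 3 → ℝ) := surfaceParam ρ '' strip y₁ y₂

end H2xR

end

namespace H2xR


/-! The Cayley transform `x + iy = 1 - 2 / (1 + X + it)` carries the half-plane `X > 0` with metric
`(dX² + dt²) / X²` to the disk. It sends infinity to `(1, 0)`, and the parabolic isometries become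
the translations in `t`. In these coordinates `S_ρ` is the set `X = exp (ρ z)`, a union of
horocycles (`surfaceParam_eq`), and every claim can be read off from this.

Curvature: the profile curve lies in a flat, totally geodesic vertical plane and contributes the
normal curvature `ρ'' / (1 + ρ'²)^(3/2)`. The orbits are horocycles, of curvature `1`, and
contribute `1 / (1 + ρ'²)^(1/2)`. The mixed term vanishes, so `K` is the product. The formal
computation stays in the disk metric and pairs covariant derivatives with the unnormalized conormal
(`extrinsicCurvature_metric`).

Proper embedding: `X` and `t` are continuous functions on the ambient space, hence bounded on
compact sets. Since `ρ` tends to infinity at both ends, its sublevel sets lie in compact intervals,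
so preimages of compact sets are compact.

Simple end: `ρ` is bounded below, so `S_ρ` lies in a horoball based at `(1, 0)`, and each horocycle
accumulates there. A geodesic avoiding `(1, 0)` at infinity is a bounded half circle in the
half-plane, so it confines `X` and `t` to a compact range. -/

/-! ### The half-space chart -/

/-- The point of the disk model whose coordinates in the upper half-space model, in which the
parabolic isometries are the horizontal translations, are `(t, X, z)`. -/
noncomputable def halfSpaceParam (X t z : ℝ) : Fin 3 → ℝ :=
  ![1 - 2 * (1 + X) / ((1 + X) ^ 2 + t ^ 2), 2 * t / ((1 + X) ^ 2 + t ^ 2), z]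

theorem surfaceParam_eq (ρ : ℝ → ℝ) (q : Fin 2 → ℝ) :
    surfaceParam ρ q = halfSpaceParam (Real.exp (ρ (q 0))) (q 1) (q 0) := by
  have hX := Real.exp_pos (ρ (q 0))
  simp only [surfaceParam, parabolic, planeParam, parabolicDenom, halfSpaceParam]
  generalize Real.exp (ρ (q 0)) = X at *
  have h1 : (1 + X) ^ 2 + q 1 ^ 2 ≠ 0 := by positivity
  have h2 : X + 1 ≠ 0 := by positivity
  have h3 : (4 + q 1 ^ 2 * ((X - 1) / (X + 1) - 1) ^ 2) ≠ 0 := by positivity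
  have h4 : (X - 1) / (X + 1) - 1 = -2 / (X + 1) := by field_simp; ring
  ext i
  fin_cases i
  · simp
    rw [h4] at *
    -- On the diameter `x - 1 = -2 / (X + 1)`, so the denominator of `F_t` is a multiple of the
    -- half-space denominator `(1 + X)² + t²`.
    have h5 : 4 + q 1 ^ 2 * (-2 / (X + 1)) ^ 2 = 4 * ((1 + X) ^ 2 + q 1 ^ 2) / (X + 1) ^ 2 := by
      field_simp; ring
    rw [h5]
    field_simp
    ring
  · simp
    rw [h4] at *
    have h5 : 4 + q 1 ^ 2 * (-2 / (X + 1)) ^ 2 = 4 * ((1 + X) ^ 2 + q 1 ^ 2) / (X + 1) ^ 2 := by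
      field_simp; ring
    rw [h5]
    field_simp
    ring
  · simp

/-! ### Openness of the parameter domain and regularity of the parametrization. -/

theorem isOpen_openInterval (y₁ y₂ : EReal) : IsOpen (openInterval y₁ y₂) :=
  (isOpen_Ioo (a := y₁) (b := y₂)).preimage continuous_coe_real_ereal

theorem isOpen_strip (y₁ y₂ : EReal) : IsOpen (strip y₁ y₂) :=
  (isOpen_openInterval y₁ y₂).preimage (continuous_apply 0)

theorem contDiffOn_surfaceParam {y₁ y₂ : EReal} {ρ : ℝ → ℝ} {n : WithTop ℕ∞}
    (h : ContDiffOn ℝ n ρ (openInterval y₁ y₂)) :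
    ContDiffOn ℝ n (surfaceParam ρ) (strip y₁ y₂) := by
  have hX : ContDiffOn ℝ n (fun q : Fin 2 → ℝ => Real.exp (ρ (q 0))) (strip y₁ y₂) :=
    (h.comp (contDiff_apply ℝ ℝ (0 : Fin 2)).contDiffOn fun q hq => hq).exp
  have ht : ContDiffOn ℝ n (fun q : Fin 2 → ℝ => q 1) (strip y₁ y₂) :=
    (contDiff_apply ℝ ℝ (1 : Fin 2)).contDiffOn
  have hD : ContDiffOn ℝ n (fun q : Fin 2 → ℝ => (1 + Real.exp (ρ (q 0))) ^ 2 + q 1 ^ 2)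
      (strip y₁ y₂) := ((contDiffOn_const.add hX).pow 2).add (ht.pow 2)
  have hD0 : ∀ q ∈ strip y₁ y₂, (1 + Real.exp (ρ (q 0))) ^ 2 + q 1 ^ 2 ≠ 0 := fun q _ => by
    positivity
  rw [show surfaceParam ρ = fun q => halfSpaceParam (Real.exp (ρ (q 0))) (q 1) (q 0) from
    funext (surfaceParam_eq ρ), contDiffOn_pi]
  intro i
  fin_cases i
  · exact contDiffOn_const.sub ((contDiffOn_const.mul (contDiffOn_const.add hX)).div hD hD0)
  · exact (contDiffOn_const.mul ht).div hD hD0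
  · exact (contDiff_apply ℝ ℝ (0 : Fin 2)).contDiffOn

/-! ### Partial derivatives -/

/-- Reduces partial derivatives to one-variable calculus. Differentiability of `u` must be known
beforehand, since `fderiv` is `0` by default where it fails. -/
theorem partialDeriv_eq_of_hasDerivAt {m : ℕ} {E : Type*} [NormedAddCommGroup E] [NormedSpace ℝ E]
    {i : Fin m} {u : (Fin m → ℝ) → E} {p : Fin m → ℝ} {d : E} (hu : DifferentiableAt ℝ u p)
    (h : HasDerivAt (fun s => u (Function.update p i s)) d (p i)) : partialDeriv i u p = d := by
  have h1 : HasFDerivAt u (fderiv ℝ u p) (Function.update p i (p i)) := by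
    rw [Function.update_eq_self]; exact hu.hasFDerivAt
  exact (h1.comp_hasDerivAt (p i) (hasDerivAt_update p i (p i))).unique h

/-- Real part of `2 / (W - i t) ^ 2`. -/
noncomputable def chartRe (W t : ℝ) : ℝ := 2 * (W ^ 2 - t ^ 2) / (W ^ 2 + t ^ 2) ^ 2

/-- Imaginary part of `2 / (W - i t) ^ 2`. -/
noncomputable def chartIm (W t : ℝ) : ℝ := 4 * t * W / (W ^ 2 + t ^ 2) ^ 2

/-- Real part of `-4 / (W - i t) ^ 3`. -/
noncomputable def chartRe' (W t : ℝ) : ℝ := -4 * (W ^ 3 - 3 * W * t ^ 2) / (W ^ 2 + t ^ 2) ^ 3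

/-- Imaginary part of `-4 / (W - i t) ^ 3`. -/
noncomputable def chartIm' (W t : ℝ) : ℝ := -4 * (3 * W ^ 2 * t - t ^ 3) / (W ^ 2 + t ^ 2) ^ 3

variable {W : ℝ}

theorem hasDerivAt_sq_add_left (W t : ℝ) : HasDerivAt (fun s => s ^ 2 + t ^ 2) (2 * W) W := by
  simpa using (hasDerivAt_pow 2 W).add_const (t ^ 2)

theorem hasDerivAt_sq_add_right (W t : ℝ) : HasDerivAt (fun s => W ^ 2 + s ^ 2) (2 * t) t := by
  simpa using (hasDerivAt_pow 2 t).const_add (W ^ 2)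

/-- The chart `1 - 2 / (W + it)` is holomorphic in `W + it` with derivative `chartRe - i chartIm`.
By the Cauchy–Riemann equations these two functions give all four first partial derivatives. -/
theorem hasDerivAt_fst_left (hW : 0 < W) (t : ℝ) :
    HasDerivAt (fun s => 1 - 2 * s / (s ^ 2 + t ^ 2)) (chartRe W t) W := by
  have h0 : W ^ 2 + t ^ 2 ≠ 0 := by positivity
  refine ((((hasDerivAt_id W).const_mul 2).div (hasDerivAt_sq_add_left W t) h0).const_sub
    1).congr_deriv ?_
  simp only [chartRe, id]; field_simp; ring

theorem hasDerivAt_fst_right (hW : 0 < W) (t : ℝ) :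
    HasDerivAt (fun s => 1 - 2 * W / (W ^ 2 + s ^ 2)) (chartIm W t) t := by
  have h0 : W ^ 2 + t ^ 2 ≠ 0 := by positivity
  refine (((hasDerivAt_const t (2 * W)).div (hasDerivAt_sq_add_right W t) h0).const_sub
    1).congr_deriv ?_
  simp only [chartIm]; field_simp; ring

theorem hasDerivAt_snd_left (hW : 0 < W) (t : ℝ) :
    HasDerivAt (fun s => 2 * t / (s ^ 2 + t ^ 2)) (-chartIm W t) W := by
  have h0 : W ^ 2 + t ^ 2 ≠ 0 := by positivity
  refine ((hasDerivAt_const W (2 * t)).div (hasDerivAt_sq_add_left W t) h0).congr_deriv ?_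
  simp only [chartIm]; field_simp; ring

theorem hasDerivAt_snd_right (hW : 0 < W) (t : ℝ) :
    HasDerivAt (fun s => 2 * s / (W ^ 2 + s ^ 2)) (chartRe W t) t := by
  have h0 : W ^ 2 + t ^ 2 ≠ 0 := by positivity
  refine (((hasDerivAt_id t).const_mul 2).div (hasDerivAt_sq_add_right W t) h0).congr_deriv ?_
  simp only [chartRe, id]; field_simp; ring

/-- Cauchy–Riemann once more: `chartRe - i chartIm` is holomorphic in `W + it` with derivative
`chartRe' - i chartIm'`. -/
theorem hasDerivAt_chartRe_left (hW : 0 < W) (t : ℝ) :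
    HasDerivAt (fun s => chartRe s t) (chartRe' W t) W := by
  have h0 : W ^ 2 + t ^ 2 ≠ 0 := by positivity
  refine ((((hasDerivAt_pow 2 W).sub_const (t ^ 2)).const_mul 2).div
    ((hasDerivAt_sq_add_left W t).pow 2) (pow_ne_zero 2 h0)).congr_deriv ?_
  simp only [chartRe']; field_simp; norm_num; ring

theorem hasDerivAt_chartRe_right (hW : 0 < W) (t : ℝ) :
    HasDerivAt (fun s => chartRe W s) (chartIm' W t) t := by
  have h0 : W ^ 2 + t ^ 2 ≠ 0 := by positivity
  refine ((((hasDerivAt_pow 2 t).const_sub (W ^ 2)).const_mul 2).div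
    ((hasDerivAt_sq_add_right W t).pow 2) (pow_ne_zero 2 h0)).congr_deriv ?_
  simp only [chartIm']; field_simp; norm_num; ring

theorem hasDerivAt_chartIm_left (hW : 0 < W) (t : ℝ) :
    HasDerivAt (fun s => chartIm s t) (chartIm' W t) W := by
  have h0 : W ^ 2 + t ^ 2 ≠ 0 := by positivity
  refine (((hasDerivAt_id W).const_mul (4 * t)).div
    ((hasDerivAt_sq_add_left W t).pow 2) (pow_ne_zero 2 h0)).congr_deriv ?_
  simp only [chartIm', id]; field_simp; norm_num; ring

theorem hasDerivAt_chartIm_right (hW : 0 < W) (t : ℝ) :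
    HasDerivAt (fun s => chartIm W s) (-chartRe' W t) t := by
  have h0 : W ^ 2 + t ^ 2 ≠ 0 := by positivity
  refine ((((hasDerivAt_id t).const_mul 4).mul_const W).div
    ((hasDerivAt_sq_add_right W t).pow 2) (pow_ne_zero 2 h0)).congr_deriv ?_
  simp only [chartRe', id]; field_simp; norm_num; ring

/-- The partial derivative `∂₀ f_ρ`, in closed form. -/
noncomputable def surfaceDeriv₀ (ρ : ℝ → ℝ) (q : Fin 2 → ℝ) : Fin 3 → ℝ :=
  ![chartRe (1 + Real.exp (ρ (q 0))) (q 1) * (Real.exp (ρ (q 0)) * deriv ρ (q 0)),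
    -chartIm (1 + Real.exp (ρ (q 0))) (q 1) * (Real.exp (ρ (q 0)) * deriv ρ (q 0)), 1]

/-- The partial derivative `∂₁ f_ρ`, in closed form. -/
noncomputable def surfaceDeriv₁ (ρ : ℝ → ℝ) (q : Fin 2 → ℝ) : Fin 3 → ℝ :=
  ![chartIm (1 + Real.exp (ρ (q 0))) (q 1), chartRe (1 + Real.exp (ρ (q 0))) (q 1), 0]

theorem differentiableAt_vec3 {u : (Fin 2 → ℝ) → Fin 3 → ℝ} {q : Fin 2 → ℝ}
    (h0 : DifferentiableAt ℝ (fun p => u p 0) q) (h1 : DifferentiableAt ℝ (fun p => u p 1) q)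
    (h2 : DifferentiableAt ℝ (fun p => u p 2) q) : DifferentiableAt ℝ u q := by
  rw [differentiableAt_pi]
  intro i
  fin_cases i
  exacts [h0, h1, h2]

theorem differentiableAt_surfaceDeriv₁ {ρ : ℝ → ℝ} {q : Fin 2 → ℝ}
    (h : DifferentiableAt ℝ ρ (q 0)) : DifferentiableAt ℝ (surfaceDeriv₁ ρ) q := by
  have hc : DifferentiableAt ℝ (fun p : Fin 2 → ℝ => ρ (p 0)) q :=
    DifferentiableAt.comp (f := fun p : Fin 2 → ℝ => p 0) q h (by fun_prop)
  have h0 : ((1 + Real.exp (ρ (q 0))) ^ 2 + q 1 ^ 2) ^ 2 ≠ 0 := by positivity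
  refine differentiableAt_vec3 ?_ ?_ (differentiableAt_const 0)
  · simp only [surfaceDeriv₁, chartIm, Matrix.cons_val, div_eq_mul_inv]
    exact DifferentiableAt.mul (by fun_prop) (DifferentiableAt.inv (by fun_prop) h0)
  · simp only [surfaceDeriv₁, chartRe, Matrix.cons_val, div_eq_mul_inv]
    exact DifferentiableAt.mul (by fun_prop) (DifferentiableAt.inv (by fun_prop) h0)

theorem differentiableAt_surfaceDeriv₀ {ρ : ℝ → ℝ} {q : Fin 2 → ℝ}
    (h : DifferentiableAt ℝ ρ (q 0)) (h' : DifferentiableAt ℝ (deriv ρ) (q 0)) :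
    DifferentiableAt ℝ (surfaceDeriv₀ ρ) q := by
  have hc : DifferentiableAt ℝ (fun p : Fin 2 → ℝ => ρ (p 0)) q :=
    DifferentiableAt.comp (f := fun p : Fin 2 → ℝ => p 0) q h (by fun_prop)
  have hc' : DifferentiableAt ℝ (fun p : Fin 2 → ℝ => deriv ρ (p 0)) q :=
    DifferentiableAt.comp (f := fun p : Fin 2 → ℝ => p 0) q h' (by fun_prop)
  have h1 := differentiableAt_pi.1 (differentiableAt_surfaceDeriv₁ h)
  have hx : DifferentiableAt ℝ
      (fun p : Fin 2 → ℝ => Real.exp (ρ (p 0)) * deriv ρ (p 0)) q := hc.exp.mul hc'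
  exact differentiableAt_vec3 ((h1 1).mul hx) ((h1 0).neg.mul hx) (differentiableAt_const 1)

theorem hasDerivAt_one_add_exp {ρ : ℝ → ℝ} {y : ℝ} (h : DifferentiableAt ℝ ρ y) :
    HasDerivAt (fun s => 1 + Real.exp (ρ s)) (Real.exp (ρ y) * deriv ρ y) y :=
  h.hasDerivAt.exp.const_add 1

theorem hasDerivAt_exp_mul_deriv {ρ : ℝ → ℝ} {y : ℝ} (h : DifferentiableAt ℝ ρ y)
    (h' : DifferentiableAt ℝ (deriv ρ) y) :
    HasDerivAt (fun s => Real.exp (ρ s) * deriv ρ s)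
      (Real.exp (ρ y) * (deriv ρ y ^ 2 + deriv (deriv ρ) y)) y :=
  (h.hasDerivAt.exp.mul h'.hasDerivAt).congr_deriv (by ring)

theorem hasDerivAt_vec3 {u : ℝ → Fin 3 → ℝ} {d : Fin 3 → ℝ} {s : ℝ}
    (h0 : HasDerivAt (fun x => u x 0) (d 0) s) (h1 : HasDerivAt (fun x => u x 1) (d 1) s)
    (h2 : HasDerivAt (fun x => u x 2) (d 2) s) : HasDerivAt u d s := by
  rw [hasDerivAt_pi]
  intro i
  fin_cases i
  exacts [h0, h1, h2]

theorem partialDeriv_zero_surfaceParam {ρ : ℝ → ℝ} {q : Fin 2 → ℝ}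
    (hf : DifferentiableAt ℝ (surfaceParam ρ) q) (h : DifferentiableAt ℝ ρ (q 0)) :
    partialDeriv 0 (surfaceParam ρ) q = surfaceDeriv₀ ρ q := by
  have hW : 0 < 1 + Real.exp (ρ (q 0)) := by positivity
  refine partialDeriv_eq_of_hasDerivAt hf ?_
  simp only [surfaceParam_eq]
  refine hasDerivAt_vec3 ?_ ?_ ?_
  · simpa [halfSpaceParam, surfaceDeriv₀, Function.comp_def] using
      (hasDerivAt_fst_left hW (q 1)).comp (q 0) (hasDerivAt_one_add_exp h)
  · simpa [halfSpaceParam, surfaceDeriv₀, Function.comp_def] using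
      (hasDerivAt_snd_left hW (q 1)).comp (q 0) (hasDerivAt_one_add_exp h)
  · simpa [halfSpaceParam, surfaceDeriv₀] using hasDerivAt_id' (q 0)

theorem partialDeriv_one_surfaceParam {ρ : ℝ → ℝ} {q : Fin 2 → ℝ}
    (hf : DifferentiableAt ℝ (surfaceParam ρ) q) :
    partialDeriv 1 (surfaceParam ρ) q = surfaceDeriv₁ ρ q := by
  have hW : 0 < 1 + Real.exp (ρ (q 0)) := by positivity
  refine partialDeriv_eq_of_hasDerivAt hf ?_
  simp only [surfaceParam_eq]
  refine hasDerivAt_vec3 ?_ ?_ ?_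
  · simpa [halfSpaceParam, surfaceDeriv₁] using hasDerivAt_fst_right hW (q 1)
  · simpa [halfSpaceParam, surfaceDeriv₁] using hasDerivAt_snd_right hW (q 1)
  · simpa [halfSpaceParam, surfaceDeriv₁] using hasDerivAt_const (q 1) (q 0)

theorem partialDeriv_zero_surfaceDeriv₀ {ρ : ℝ → ℝ} {q : Fin 2 → ℝ}
    (h : DifferentiableAt ℝ ρ (q 0)) (h' : DifferentiableAt ℝ (deriv ρ) (q 0)) :
    partialDeriv 0 (surfaceDeriv₀ ρ) q =
      ![chartRe' (1 + Real.exp (ρ (q 0))) (q 1) * (Real.exp (ρ (q 0)) * deriv ρ (q 0)) ^ 2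
          + chartRe (1 + Real.exp (ρ (q 0))) (q 1) *
            (Real.exp (ρ (q 0)) * (deriv ρ (q 0) ^ 2 + deriv (deriv ρ) (q 0))),
        -(chartIm' (1 + Real.exp (ρ (q 0))) (q 1) * (Real.exp (ρ (q 0)) * deriv ρ (q 0)) ^ 2
          + chartIm (1 + Real.exp (ρ (q 0))) (q 1) *
            (Real.exp (ρ (q 0)) * (deriv ρ (q 0) ^ 2 + deriv (deriv ρ) (q 0)))), 0] := by
  have hW : 0 < 1 + Real.exp (ρ (q 0)) := by positivity
  refine partialDeriv_eq_of_hasDerivAt (differentiableAt_surfaceDeriv₀ h h') ?_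
  have hx := hasDerivAt_exp_mul_deriv h h'
  refine hasDerivAt_vec3 ?_ ?_ ?_
  · have := ((hasDerivAt_chartRe_left hW (q 1)).comp (q 0) (hasDerivAt_one_add_exp h)).mul hx
    simp only [Function.comp_def] at this
    simp [surfaceDeriv₀]
    exact this.congr_deriv (by ring)
  · have := ((hasDerivAt_chartIm_left hW (q 1)).comp (q 0) (hasDerivAt_one_add_exp h)).neg.mul hx
    simp only [Function.comp_def] at this
    simp [surfaceDeriv₀, -neg_mul]
    exact this.congr_deriv (by simp; ring)
  · simpa [surfaceDeriv₀] using hasDerivAt_const (q 0) (1 : ℝ)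

theorem partialDeriv_zero_surfaceDeriv₁ {ρ : ℝ → ℝ} {q : Fin 2 → ℝ}
    (h : DifferentiableAt ℝ ρ (q 0)) :
    partialDeriv 0 (surfaceDeriv₁ ρ) q =
      ![chartIm' (1 + Real.exp (ρ (q 0))) (q 1) * (Real.exp (ρ (q 0)) * deriv ρ (q 0)),
        chartRe' (1 + Real.exp (ρ (q 0))) (q 1) * (Real.exp (ρ (q 0)) * deriv ρ (q 0)), 0] := by
  have hW : 0 < 1 + Real.exp (ρ (q 0)) := by positivity
  refine partialDeriv_eq_of_hasDerivAt (differentiableAt_surfaceDeriv₁ h) ?_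
  refine hasDerivAt_vec3 ?_ ?_ ?_
  · simpa [surfaceDeriv₁, Function.comp_def] using
      (hasDerivAt_chartIm_left hW (q 1)).comp (q 0) (hasDerivAt_one_add_exp h)
  · simpa [surfaceDeriv₁, Function.comp_def] using
      (hasDerivAt_chartRe_left hW (q 1)).comp (q 0) (hasDerivAt_one_add_exp h)
  · simpa [surfaceDeriv₁] using hasDerivAt_const (q 0) (0 : ℝ)

theorem partialDeriv_one_surfaceDeriv₁ {ρ : ℝ → ℝ} {q : Fin 2 → ℝ}
    (h : DifferentiableAt ℝ ρ (q 0)) :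
    partialDeriv 1 (surfaceDeriv₁ ρ) q =
      ![-chartRe' (1 + Real.exp (ρ (q 0))) (q 1), chartIm' (1 + Real.exp (ρ (q 0))) (q 1), 0] := by
  have hW : 0 < 1 + Real.exp (ρ (q 0)) := by positivity
  refine partialDeriv_eq_of_hasDerivAt (differentiableAt_surfaceDeriv₁ h) ?_
  refine hasDerivAt_vec3 ?_ ?_ ?_
  · simpa [surfaceDeriv₁] using hasDerivAt_chartIm_right hW (q 1)
  · simpa [surfaceDeriv₁] using hasDerivAt_chartRe_right hW (q 1)
  · simpa [surfaceDeriv₁] using hasDerivAt_const (q 1) (0 : ℝ)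


/-! ### The Levi-Civita connection of `ℍ² × ℝ` -/

/-- The conformal factor of the Poincaré metric. -/
noncomputable def conformalFactor (p : Fin 3 → ℝ) : ℝ := 4 / (1 - (p 0 ^ 2 + p 1 ^ 2)) ^ 2

theorem metric_apply (p : Fin 3 → ℝ) (j l : Fin 3) :
    metric p j l = conformalFactor p * Matrix.diagonal ![1, 1, 0] j l
      + Matrix.diagonal ![0, 0, 1] j l := by
  fin_cases j <;> fin_cases l <;> simp [metric, conformalFactor]

theorem inv_metric {p : Fin 3 → ℝ} (hp : p ∈ space) :
    (metric p)⁻¹ = Matrix.diagonal ![(conformalFactor p)⁻¹, (conformalFactor p)⁻¹, 1] := by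
  have h : 1 - (p 0 ^ 2 + p 1 ^ 2) ≠ 0 := (sub_pos.2 hp).ne'
  refine Matrix.inv_eq_right_inv ?_
  rw [metric, Matrix.diagonal_mul_diagonal, ← Matrix.diagonal_one]
  congr 1
  ext i
  fin_cases i <;> simp [conformalFactor, h]

theorem differentiableAt_conformalFactor {p : Fin 3 → ℝ} (hp : p ∈ space) :
    DifferentiableAt ℝ conformalFactor p := by
  have h : (1 - (p 0 ^ 2 + p 1 ^ 2)) ^ 2 ≠ 0 := pow_ne_zero 2 (sub_pos.2 hp).ne'
  unfold conformalFactor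
  simp only [div_eq_mul_inv]
  exact DifferentiableAt.mul (by fun_prop) (DifferentiableAt.inv (by fun_prop) h)

theorem hasDerivAt_four_div_sq {c x : ℝ} (h : 1 - (c + x ^ 2) ≠ 0) :
    HasDerivAt (fun s : ℝ => 4 / (1 - (c + s ^ 2)) ^ 2) (16 * x / (1 - (c + x ^ 2)) ^ 3) x := by
  refine ((hasDerivAt_const x (4 : ℝ)).div
    ((((hasDerivAt_pow 2 x).const_add c).const_sub 1).pow 2) (pow_ne_zero 2 h)).congr_deriv ?_
  field_simp
  norm_num
  ring

theorem partialDeriv_conformalFactor {p : Fin 3 → ℝ} (hp : p ∈ space) (i : Fin 3) :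
    partialDeriv i conformalFactor p =
      ![16 * p 0 / (1 - (p 0 ^ 2 + p 1 ^ 2)) ^ 3, 16 * p 1 / (1 - (p 0 ^ 2 + p 1 ^ 2)) ^ 3, 0] i := by
  have h : 1 - (p 0 ^ 2 + p 1 ^ 2) ≠ 0 := (sub_pos.2 hp).ne'
  refine partialDeriv_eq_of_hasDerivAt (differentiableAt_conformalFactor hp) ?_
  fin_cases i
  · have h' : 1 - (p 1 ^ 2 + p 0 ^ 2) ≠ 0 := by rwa [add_comm]
    have := hasDerivAt_four_div_sq h'
    simpa [conformalFactor, add_comm] using this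
  · simpa [conformalFactor] using hasDerivAt_four_div_sq h
  · simpa [conformalFactor] using hasDerivAt_const (p 2) _

theorem partialDeriv_metric {p : Fin 3 → ℝ} (hp : p ∈ space) (i j l : Fin 3) :
    partialDeriv i (fun q => metric q j l) p =
      partialDeriv i conformalFactor p * Matrix.diagonal ![1, 1, 0] j l := by
  simp only [metric_apply, partialDeriv]
  rw [fderiv_add_const, fderiv_mul_const (differentiableAt_conformalFactor hp)]
  simp [mul_comm]

theorem christoffel_metric {p : Fin 3 → ℝ} (hp : p ∈ space) (k i j : Fin 3) :
    christoffel metric p k i j = 2 / (1 - (p 0 ^ 2 + p 1 ^ 2)) *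
      (![p 0, p 1, 0] i * Matrix.diagonal ![1, 1, 0] j k
        + ![p 0, p 1, 0] j * Matrix.diagonal ![1, 1, 0] i k
        - ![p 0, p 1, 0] k * Matrix.diagonal ![1, 1, 0] i j) := by
  have h : 1 - (p 0 ^ 2 + p 1 ^ 2) ≠ 0 := (sub_pos.2 hp).ne'
  have hs : ∀ (M : Fin 3 → ℝ), ∑ l, Matrix.diagonal
      ![(conformalFactor p)⁻¹, (conformalFactor p)⁻¹, 1] k l * M l =
        ![(conformalFactor p)⁻¹, (conformalFactor p)⁻¹, 1] k * M k := by
    intro M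
    simp [Matrix.diagonal_apply]
  have hd : ∀ i, partialDeriv i conformalFactor p =
      16 / (1 - (p 0 ^ 2 + p 1 ^ 2)) ^ 3 * ![p 0, p 1, 0] i := by
    intro i
    rw [partialDeriv_conformalFactor hp]
    fin_cases i <;> simp <;> ring
  simp only [christoffel, partialDeriv_metric hp, inv_metric hp, hs, hd]
  -- Only horizontal `k` see the conformal factor; for `k = 2` every term of the bracket vanishes.
  have hk : ![(conformalFactor p)⁻¹, (conformalFactor p)⁻¹, 1] k =
      (1 - (p 0 ^ 2 + p 1 ^ 2)) ^ 2 / 4 ∨ k = 2 := by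
    fin_cases k <;> simp [conformalFactor]
  rcases hk with hk | rfl
  · rw [hk]
    field_simp
    ring
  · have h2 : ∀ i : Fin 3, Matrix.diagonal ![(1 : ℝ), 1, 0] i 2 = 0 := by
      intro i
      fin_cases i <;> simp
    simp [h2]

/-- In complex notation the horizontal part is `u + 2 z̄ v w / (1 - |z|²)`, the Levi-Civita
connection of the Poincaré disk; the vertical factor is flat. -/
theorem covDeriv_metric {f : (Fin 2 → ℝ) → (Fin 3 → ℝ)} {q : Fin 2 → ℝ} (hp : f q ∈ space)
    (a b : Fin 2) {v w u : Fin 3 → ℝ} (hv : partialDeriv a f q = v) (hw : partialDeriv b f q = w)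
    (hu : partialDeriv a (partialDeriv b f) q = u) :
    covDeriv metric f a b q =
      ![u 0 + 2 / (1 - (f q 0 ^ 2 + f q 1 ^ 2)) *
          (f q 0 * (v 0 * w 0 - v 1 * w 1) + f q 1 * (v 0 * w 1 + v 1 * w 0)),
        u 1 + 2 / (1 - (f q 0 ^ 2 + f q 1 ^ 2)) *
          (f q 0 * (v 0 * w 1 + v 1 * w 0) - f q 1 * (v 0 * w 0 - v 1 * w 1)),
        u 2] := by
  ext k
  simp only [covDeriv, hv, hw, hu, christoffel_metric hp, Fin.sum_univ_three]
  fin_cases k <;> simp <;> ring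

/-! ### Extrinsic curvature in terms of the conormal `∂₀ f × ∂₁ f` -/

/-- The determinant of the pairing of the covariant derivatives with the conormal determines the
extrinsic curvature. -/
theorem extrinsicCurvature_metric {f : (Fin 2 → ℝ) → (Fin 3 → ℝ)} {q : Fin 2 → ℝ}
    (hp : f q ∈ space) {v w n : Fin 3 → ℝ} (hv : partialDeriv 0 f q = v)
    (hw : partialDeriv 1 f q = w) (hn : crossProduct v w = n) (hn0 : n ≠ 0) :
    extrinsicCurvature metric f q =
      (covDeriv metric f 0 0 q ⬝ᵥ n * (covDeriv metric f 1 1 q ⬝ᵥ n)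
        - covDeriv metric f 0 1 q ⬝ᵥ n * (covDeriv metric f 1 0 q ⬝ᵥ n)) /
      ((n 0 ^ 2 + n 1 ^ 2) + conformalFactor (f q) * n 2 ^ 2) ^ 2 := by
  have h : 0 < 1 - (f q 0 ^ 2 + f q 1 ^ 2) := sub_pos.2 hp
  have hl : 0 < conformalFactor (f q) := by unfold conformalFactor; positivity
  have hg : metric (f q) = Matrix.diagonal ![conformalFactor (f q), conformalFactor (f q), 1] := rfl
  set l := conformalFactor (f q) with hl_def
  have hsum : 0 < n 0 ^ 2 + n 1 ^ 2 + l * n 2 ^ 2 := by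
    refine lt_of_le_of_ne (by positivity) fun h0 => hn0 ?_
    have h1 : 0 ≤ l * n 2 ^ 2 := by positivity
    have e0 : n 0 ^ 2 = 0 := by nlinarith [sq_nonneg (n 0), sq_nonneg (n 1)]
    have e1 : n 1 ^ 2 = 0 := by nlinarith [sq_nonneg (n 0), sq_nonneg (n 1)]
    have e2 : l * n 2 ^ 2 = 0 := by nlinarith [sq_nonneg (n 0), sq_nonneg (n 1)]
    ext i
    fin_cases i
    · simpa using e0
    · simpa using e1
    · simpa [hl.ne'] using e2
  -- Raising the index of `n` and then pairing by the metric cancels, leaving the plain dot product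
  -- with `n` over the `g`-length of the raised vector.
  have hII : ∀ a b, secondForm metric f q a b =
      (Real.sqrt (((n 0 ^ 2 + n 1 ^ 2) + l * n 2 ^ 2) / l))⁻¹ * (covDeriv metric f a b q ⬝ᵥ n) := by
    intro a b
    have e : metricInner metric (f q) ((metric (f q))⁻¹.mulVec n) ((metric (f q))⁻¹.mulVec n) =
        ((n 0 ^ 2 + n 1 ^ 2) + l * n 2 ^ 2) / l := by
      rw [metricInner, inv_metric hp, hg]
      simp [Matrix.mulVec_diagonal, dotProduct, Fin.sum_univ_three, ← hl_def]
      field_simp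
    simp only [secondForm, Matrix.of_apply, unitNormal, hv, hw, hn, e]
    rw [metricInner, inv_metric hp, hg]
    simp [Matrix.mulVec_diagonal, dotProduct, Fin.sum_univ_three, ← hl_def]
    field_simp
  -- Lagrange's identity for the cross product, in the form `det I = det g * (n ⬝ g⁻¹ n)`.
  have hI : (firstForm metric f q).det = l * ((n 0 ^ 2 + n 1 ^ 2) + l * n 2 ^ 2) := by
    rw [Matrix.det_fin_two]
    simp only [firstForm, Matrix.of_apply, metricInner, hv, hw, hg, ← hn]
    simp [Matrix.mulVec_diagonal, dotProduct, Fin.sum_univ_three, cross_apply]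
    ring
  have hs : Real.sqrt (((n 0 ^ 2 + n 1 ^ 2) + l * n 2 ^ 2) / l) ^ 2 =
      ((n 0 ^ 2 + n 1 ^ 2) + l * n 2 ^ 2) / l := Real.sq_sqrt (by positivity)
  have hs' : (Real.sqrt (((n 0 ^ 2 + n 1 ^ 2) + l * n 2 ^ 2) / l))⁻¹ ^ 2 =
      l / ((n 0 ^ 2 + n 1 ^ 2) + l * n 2 ^ 2) := by rw [inv_pow, hs, inv_div]
  rw [extrinsicCurvature, hI, Matrix.det_fin_two, hII, hII, hII, hII]
  generalize (Real.sqrt (((n 0 ^ 2 + n 1 ^ 2) + l * n 2 ^ 2) / l))⁻¹ = c at hs'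
  generalize n 0 ^ 2 + n 1 ^ 2 + l * n 2 ^ 2 = m at *
  have hfac : ∀ x y z t : ℝ, c * x * (c * y) - c * z * (c * t) = c ^ 2 * (x * y - z * t) := by
    intros; ring
  rw [hfac, hs']
  field_simp

/-! ### The curvature of `S_ρ` -/

theorem one_sub_normSq_halfSpaceParam {X : ℝ} (hX : 0 < X) (t z : ℝ) :
    1 - (halfSpaceParam X t z 0 ^ 2 + halfSpaceParam X t z 1 ^ 2) =
      4 * X / ((1 + X) ^ 2 + t ^ 2) := by
  simp only [halfSpaceParam, Matrix.cons_val]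
  field_simp
  ring

theorem halfSpaceParam_mem_space {X : ℝ} (hX : 0 < X) (t z : ℝ) :
    halfSpaceParam X t z ∈ space := by
  have h := one_sub_normSq_halfSpaceParam hX t z
  have : 0 < 4 * X / ((1 + X) ^ 2 + t ^ 2) := by positivity
  exact sub_pos.1 (h ▸ this)

theorem surfaceParam_mem_space (ρ : ℝ → ℝ) (q : Fin 2 → ℝ) : surfaceParam ρ q ∈ space := by
  rw [surfaceParam_eq]
  exact halfSpaceParam_mem_space (Real.exp_pos _) _ _

theorem chartRe_sq_add_chartIm_sq {W : ℝ} (hW : 0 < W) (t : ℝ) :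
    chartRe W t ^ 2 + chartIm W t ^ 2 = 4 / (W ^ 2 + t ^ 2) ^ 2 := by
  simp only [chartRe, chartIm]
  field_simp
  ring

/-- The conormal `∂₀ f × ∂₁ f` of `S_ρ`, with `X = exp ρ` and `r = ρ'`. -/
noncomputable def conormal (X t r : ℝ) : Fin 3 → ℝ :=
  ![-chartRe (1 + X) t, chartIm (1 + X) t, X * r * (4 / ((1 + X) ^ 2 + t ^ 2) ^ 2)]

theorem crossProduct_surfaceDeriv (ρ : ℝ → ℝ) (q : Fin 2 → ℝ) :
    crossProduct (surfaceDeriv₀ ρ q) (surfaceDeriv₁ ρ q) =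
      conormal (Real.exp (ρ (q 0))) (q 1) (deriv ρ (q 0)) := by
  have hX := Real.exp_pos (ρ (q 0))
  rw [conormal, ← chartRe_sq_add_chartIm_sq (by positivity)]
  simp only [cross_apply, surfaceDeriv₀, surfaceDeriv₁, Matrix.cons_val]
  ext i
  fin_cases i <;> simp
  ring

theorem conormal_ne_zero {X : ℝ} (hX : 0 < X) (t r : ℝ) : conormal X t r ≠ 0 := by
  intro h
  have h0 : -chartRe (1 + X) t = 0 := congrFun h 0
  have h1 : chartIm (1 + X) t = 0 := congrFun h 1
  have h2 := chartRe_sq_add_chartIm_sq (W := 1 + X) (by positivity) t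
  rw [neg_eq_zero.1 h0, h1] at h2
  have : 0 < 4 / ((1 + X) ^ 2 + t ^ 2) ^ 2 := by positivity
  linarith

theorem conormal_normSq {X : ℝ} (hX : 0 < X) (t r z : ℝ) :
    (conormal X t r 0 ^ 2 + conormal X t r 1 ^ 2) +
      conformalFactor (halfSpaceParam X t z) * conormal X t r 2 ^ 2 =
      4 * (1 + r ^ 2) / ((1 + X) ^ 2 + t ^ 2) ^ 2 := by
  rw [conformalFactor, one_sub_normSq_halfSpaceParam hX]
  simp only [conormal, Matrix.cons_val, neg_sq]
  rw [chartRe_sq_add_chartIm_sq (by positivity)]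
  field_simp

section Curvature

variable {y₁ y₂ : EReal} {ρ : ℝ → ℝ} {q : Fin 2 → ℝ}

theorem differentiableAt_of_mem_strip {g : ℝ → ℝ} (hg : DifferentiableOn ℝ g (openInterval y₁ y₂))
    (hq : q ∈ strip y₁ y₂) : DifferentiableAt ℝ g (q 0) :=
  hg.differentiableAt ((isOpen_openInterval y₁ y₂).mem_nhds hq)

/-- A differentiable `ρ'` is continuous, so `ρ` is `C¹`, and the regularity of `ρ` passes to the
surface. -/
theorem contDiffOn_one_surfaceParam (hρ : DifferentiableOn ℝ ρ (openInterval y₁ y₂))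
    (hρ' : DifferentiableOn ℝ (deriv ρ) (openInterval y₁ y₂)) :
    ContDiffOn ℝ 1 (surfaceParam ρ) (strip y₁ y₂) := by
  refine contDiffOn_surfaceParam ?_
  rw [show (1 : WithTop ℕ∞) = 0 + 1 from (zero_add 1).symm,
    contDiffOn_succ_iff_deriv_of_isOpen (isOpen_openInterval y₁ y₂)]
  exact ⟨hρ, by simp, contDiffOn_zero.2 hρ'.continuousOn⟩

theorem differentiableAt_surfaceParam (hρ : DifferentiableOn ℝ ρ (openInterval y₁ y₂))
    (hρ' : DifferentiableOn ℝ (deriv ρ) (openInterval y₁ y₂)) (hq : q ∈ strip y₁ y₂) :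
    DifferentiableAt ℝ (surfaceParam ρ) q :=
  ((contDiffOn_one_surfaceParam hρ hρ').differentiableOn one_ne_zero).differentiableAt
    ((isOpen_strip y₁ y₂).mem_nhds hq)

theorem partialDeriv_surfaceParam_zero_eqOn (hρ : DifferentiableOn ℝ ρ (openInterval y₁ y₂))
    (hρ' : DifferentiableOn ℝ (deriv ρ) (openInterval y₁ y₂)) :
    EqOn (partialDeriv 0 (surfaceParam ρ)) (surfaceDeriv₀ ρ) (strip y₁ y₂) := fun _ hq =>
  partialDeriv_zero_surfaceParam (differentiableAt_surfaceParam hρ hρ' hq)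
    (differentiableAt_of_mem_strip hρ hq)

theorem partialDeriv_surfaceParam_one_eqOn (hρ : DifferentiableOn ℝ ρ (openInterval y₁ y₂))
    (hρ' : DifferentiableOn ℝ (deriv ρ) (openInterval y₁ y₂)) :
    EqOn (partialDeriv 1 (surfaceParam ρ)) (surfaceDeriv₁ ρ) (strip y₁ y₂) := fun _ hq =>
  partialDeriv_one_surfaceParam (differentiableAt_surfaceParam hρ hρ' hq)

/-- The closed forms of the first derivatives hold only on the open strip; this allows them to be
differentiated again there. -/
theorem partialDeriv_congr {m : ℕ} {E : Type*} [NormedAddCommGroup E] [NormedSpace ℝ E]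
    {u v : (Fin m → ℝ) → E} {s : Set (Fin m → ℝ)} {p : Fin m → ℝ} (h : EqOn u v s)
    (hs : IsOpen s) (hp : p ∈ s) (i : Fin m) : partialDeriv i u p = partialDeriv i v p := by
  rw [partialDeriv, partialDeriv, (h.eventuallyEq_of_mem (hs.mem_nhds hp)).fderiv_eq]

/-- The vertical plane containing the profile is flat and totally geodesic, which is why all terms
in `ρ'` cancel and only `ρ''` survives. -/
theorem covDeriv_zero_zero_dotProduct_conormal
    (hρ : DifferentiableOn ℝ ρ (openInterval y₁ y₂))
    (hρ' : DifferentiableOn ℝ (deriv ρ) (openInterval y₁ y₂)) (hq : q ∈ strip y₁ y₂) :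
    covDeriv metric (surfaceParam ρ) 0 0 q ⬝ᵥ
        conormal (Real.exp (ρ (q 0))) (q 1) (deriv ρ (q 0)) =
      -4 * Real.exp (ρ (q 0)) * deriv (deriv ρ) (q 0) /
        ((1 + Real.exp (ρ (q 0))) ^ 2 + q 1 ^ 2) ^ 2 := by
  have e0 := partialDeriv_surfaceParam_zero_eqOn hρ hρ'
  rw [covDeriv_metric (surfaceParam_mem_space ρ q) 0 0 (e0 hq) (e0 hq)
    ((partialDeriv_congr e0 (isOpen_strip y₁ y₂) hq 0).trans
      (partialDeriv_zero_surfaceDeriv₀ (differentiableAt_of_mem_strip hρ hq)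
        (differentiableAt_of_mem_strip hρ' hq)))]
  have hX := Real.exp_pos (ρ (q 0))
  rw [surfaceParam_eq, one_sub_normSq_halfSpaceParam hX]
  simp only [dotProduct, Fin.sum_univ_three, conormal, surfaceDeriv₀, halfSpaceParam,
    Matrix.cons_val, chartRe, chartIm, chartRe', chartIm']
  generalize Real.exp (ρ (q 0)) = X at *
  field_simp
  ring

theorem covDeriv_one_one_dotProduct_conormal
    (hρ : DifferentiableOn ℝ ρ (openInterval y₁ y₂))
    (hρ' : DifferentiableOn ℝ (deriv ρ) (openInterval y₁ y₂)) (hq : q ∈ strip y₁ y₂) :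
    covDeriv metric (surfaceParam ρ) 1 1 q ⬝ᵥ
        conormal (Real.exp (ρ (q 0))) (q 1) (deriv ρ (q 0)) =
      -4 / (Real.exp (ρ (q 0)) * ((1 + Real.exp (ρ (q 0))) ^ 2 + q 1 ^ 2) ^ 2) := by
  have e1 := partialDeriv_surfaceParam_one_eqOn hρ hρ'
  rw [covDeriv_metric (surfaceParam_mem_space ρ q) 1 1 (e1 hq) (e1 hq)
    ((partialDeriv_congr e1 (isOpen_strip y₁ y₂) hq 1).trans
      (partialDeriv_one_surfaceDeriv₁ (differentiableAt_of_mem_strip hρ hq)))]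
  have hX := Real.exp_pos (ρ (q 0))
  rw [surfaceParam_eq, one_sub_normSq_halfSpaceParam hX]
  simp only [dotProduct, Fin.sum_univ_three, conormal, surfaceDeriv₁, halfSpaceParam,
    Matrix.cons_val, chartRe, chartIm, chartRe', chartIm']
  generalize Real.exp (ρ (q 0)) = X at *
  field_simp
  ring

/-- Reflection in the vertical plane of a profile curve preserves the surface, so the coordinate
lines are lines of curvature. -/
theorem covDeriv_zero_one_dotProduct_conormal
    (hρ : DifferentiableOn ℝ ρ (openInterval y₁ y₂))
    (hρ' : DifferentiableOn ℝ (deriv ρ) (openInterval y₁ y₂)) (hq : q ∈ strip y₁ y₂) :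
    covDeriv metric (surfaceParam ρ) 0 1 q ⬝ᵥ
        conormal (Real.exp (ρ (q 0))) (q 1) (deriv ρ (q 0)) = 0 := by
  have e1 := partialDeriv_surfaceParam_one_eqOn hρ hρ'
  rw [covDeriv_metric (surfaceParam_mem_space ρ q) 0 1
    (partialDeriv_surfaceParam_zero_eqOn hρ hρ' hq) (e1 hq)
    ((partialDeriv_congr e1 (isOpen_strip y₁ y₂) hq 0).trans
      (partialDeriv_zero_surfaceDeriv₁ (differentiableAt_of_mem_strip hρ hq)))]
  have hX := Real.exp_pos (ρ (q 0))
  rw [surfaceParam_eq, one_sub_normSq_halfSpaceParam hX]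
  simp only [dotProduct, Fin.sum_univ_three, conormal, surfaceDeriv₀, surfaceDeriv₁,
    halfSpaceParam, Matrix.cons_val, chartRe, chartIm, chartRe', chartIm']
  generalize Real.exp (ρ (q 0)) = X at *
  field_simp
  ring

theorem extrinsicCurvature_surfaceParam (hρ : DifferentiableOn ℝ ρ (openInterval y₁ y₂))
    (hρ' : DifferentiableOn ℝ (deriv ρ) (openInterval y₁ y₂)) (hq : q ∈ strip y₁ y₂) :
    extrinsicCurvature metric (surfaceParam ρ) q =
      deriv (deriv ρ) (q 0) / (1 + deriv ρ (q 0) ^ 2) ^ 2 := by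
  have hX := Real.exp_pos (ρ (q 0))
  -- The off-diagonal product dies through its `(0, 1)` factor, so the `(1, 0)` entry is never
  -- computed.
  rw [extrinsicCurvature_metric (surfaceParam_mem_space ρ q)
    (partialDeriv_surfaceParam_zero_eqOn hρ hρ' hq)
    (partialDeriv_surfaceParam_one_eqOn hρ hρ' hq) (crossProduct_surfaceDeriv ρ q)
    (conormal_ne_zero hX _ _), covDeriv_zero_zero_dotProduct_conormal hρ hρ' hq,
    covDeriv_one_one_dotProduct_conormal hρ hρ' hq,
    covDeriv_zero_one_dotProduct_conormal hρ hρ' hq, surfaceParam_eq, conormal_normSq hX]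
  field_simp
  norm_num

end Curvature


/-! ### Sublevel sets of `ρ` -/

theorem exists_Icc_of_tendsto {y₁ y₂ : EReal} (hy : y₁ < y₂) {ρ : ℝ → ℝ}
    (hlim₁ : Tendsto ρ (comap Real.toEReal (𝓝[>] y₁)) atTop)
    (hlim₂ : Tendsto ρ (comap Real.toEReal (𝓝[<] y₂)) atTop) (R : ℝ) :
    ∃ a b : ℝ, Icc a b ⊆ openInterval y₁ y₂ ∧
      ∀ y ∈ openInterval y₁ y₂, ρ y ≤ R → y ∈ Icc a b := by
  obtain ⟨s, hs, hsR⟩ := mem_comap.1 (hlim₁ (Ioi_mem_atTop R))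
  obtain ⟨t, ht, htR⟩ := mem_comap.1 (hlim₂ (Ioi_mem_atTop R))
  obtain ⟨u, hu, hus⟩ := (mem_nhdsGT_iff_exists_Ioo_subset' hy).1 hs
  obtain ⟨v, hv, hvt⟩ := (mem_nhdsLT_iff_exists_Ioo_subset' hy).1 ht
  obtain ⟨a, ha, ha'⟩ := EReal.lt_iff_exists_real_btwn.1 (lt_min hu hy)
  obtain ⟨b, hb, hb'⟩ := EReal.lt_iff_exists_real_btwn.1 (max_lt hv hy)
  refine ⟨a, b, fun y h => ⟨ha.trans_le (EReal.coe_le_coe_iff.2 h.1),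
    (EReal.coe_le_coe_iff.2 h.2).trans_lt hb'⟩, fun y h hR => ⟨?_, ?_⟩⟩
  · by_contra! hlt
    have : y ∈ ρ ⁻¹' Ioi R := hsR (hus ⟨h.1,
      (EReal.coe_lt_coe_iff.2 hlt).trans (ha'.trans_le (min_le_left _ _))⟩)
    exact absurd hR (not_le.2 this)
  · by_contra! hlt
    have : y ∈ ρ ⁻¹' Ioi R := htR (hvt ⟨((le_max_left _ _).trans_lt hb).trans
      (EReal.coe_lt_coe_iff.2 hlt), h.2⟩)
    exact absurd hR (not_le.2 this)

theorem exists_lower_bound {y₁ y₂ : EReal} (hy : y₁ < y₂) {ρ : ℝ → ℝ}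
    (hρ : ContinuousOn ρ (openInterval y₁ y₂))
    (hlim₁ : Tendsto ρ (comap Real.toEReal (𝓝[>] y₁)) atTop)
    (hlim₂ : Tendsto ρ (comap Real.toEReal (𝓝[<] y₂)) atTop) :
    ∃ c, ∀ y ∈ openInterval y₁ y₂, c ≤ ρ y := by
  obtain ⟨a, b, hab, h⟩ := exists_Icc_of_tendsto hy hlim₁ hlim₂ 0
  obtain ⟨C, hC⟩ := isCompact_Icc.exists_bound_of_continuousOn (hρ.mono hab)
  -- Where `ρ ≤ 0` the point lies in the compact interval and `C` bounds `|ρ|`; elsewhere any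
  -- nonpositive constant works.
  refine ⟨-|C|, fun y hyI => ?_⟩
  rcases le_total (ρ y) 0 with h0 | h0
  · have h1 := hC y (h y hyI h0)
    rw [Real.norm_eq_abs] at h1
    linarith [neg_abs_le (ρ y), le_abs_self C]
  · linarith [abs_nonneg C]

theorem mem_Icc_vec2 {a b c d : ℝ} {q : Fin 2 → ℝ} :
    q ∈ Icc ![a, c] ![b, d] ↔ q 0 ∈ Icc a b ∧ q 1 ∈ Icc c d := by
  simp only [mem_Icc, Pi.le_def, Fin.forall_fin_two, Matrix.cons_val]
  tauto

/-! ### The inverse chart -/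

/-- The height coordinate of the upper half-space model. -/
noncomputable def horoHeight (p : Fin 3 → ℝ) : ℝ :=
  (1 - (p 0 ^ 2 + p 1 ^ 2)) / ((p 0 - 1) ^ 2 + p 1 ^ 2)

/-- The horizontal coordinate of the upper half-space model. -/
noncomputable def horoTranslation (p : Fin 3 → ℝ) : ℝ := 2 * p 1 / ((p 0 - 1) ^ 2 + p 1 ^ 2)

theorem sub_one_normSq_pos {p : Fin 3 → ℝ} (hp : p ∈ space) : 0 < (p 0 - 1) ^ 2 + p 1 ^ 2 := by
  have h : p 0 ^ 2 + p 1 ^ 2 < 1 := hp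
  nlinarith [sq_nonneg (p 0 - 1), sq_nonneg (p 1)]

theorem continuousOn_horoHeight : ContinuousOn horoHeight space :=
  ContinuousOn.div (by fun_prop) (by fun_prop) fun _ hp => (sub_one_normSq_pos hp).ne'

theorem continuousOn_horoTranslation : ContinuousOn horoTranslation space :=
  ContinuousOn.div (by fun_prop) (by fun_prop) fun _ hp => (sub_one_normSq_pos hp).ne'

theorem sub_one_normSq_halfSpaceParam {X : ℝ} (hX : 0 < X) (t z : ℝ) :
    (halfSpaceParam X t z 0 - 1) ^ 2 + halfSpaceParam X t z 1 ^ 2 =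
      4 / ((1 + X) ^ 2 + t ^ 2) := by
  simp only [halfSpaceParam, Matrix.cons_val]
  field_simp
  ring

theorem horoHeight_halfSpaceParam {X : ℝ} (hX : 0 < X) (t z : ℝ) :
    horoHeight (halfSpaceParam X t z) = X := by
  rw [horoHeight, one_sub_normSq_halfSpaceParam hX, sub_one_normSq_halfSpaceParam hX]
  field_simp

theorem horoTranslation_halfSpaceParam {X : ℝ} (hX : 0 < X) (t z : ℝ) :
    horoTranslation (halfSpaceParam X t z) = t := by
  rw [horoTranslation, sub_one_normSq_halfSpaceParam hX]
  simp only [halfSpaceParam, Matrix.cons_val]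
  field_simp
  ring

theorem injective_surfaceParam (ρ : ℝ → ℝ) : Function.Injective (surfaceParam ρ) := by
  intro q q' h
  rw [surfaceParam_eq, surfaceParam_eq] at h
  ext i
  fin_cases i
  · exact congrFun h 2
  · simpa [horoTranslation_halfSpaceParam (Real.exp_pos _)] using congrArg horoTranslation h

/-! ### Proper embeddedness -/

section Surface

variable {y₁ y₂ : EReal} {ρ : ℝ → ℝ}

theorem exists_box_of_isCompact (hy : y₁ < y₂)
    (hlim₁ : Tendsto ρ (comap Real.toEReal (𝓝[>] y₁)) atTop)
    (hlim₂ : Tendsto ρ (comap Real.toEReal (𝓝[<] y₂)) atTop) (R T : ℝ) :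
    ∃ B : Set (Fin 2 → ℝ), IsCompact B ∧ B ⊆ strip y₁ y₂ ∧
      ∀ q ∈ strip y₁ y₂, ρ (q 0) ≤ R → |q 1| ≤ T → q ∈ B := by
  obtain ⟨a, b, hab, h⟩ := exists_Icc_of_tendsto hy hlim₁ hlim₂ R
  refine ⟨Icc ![a, -T] ![b, T], isCompact_Icc, fun q hq => hab (mem_Icc_vec2.1 hq).1,
    fun q hq hR hT => mem_Icc_vec2.2 ⟨h _ hq hR, abs_le.1 hT⟩⟩

theorem isProperMap_restrict_surfaceParam (hy : y₁ < y₂)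
    (hc : ContinuousOn (surfaceParam ρ) (strip y₁ y₂))
    (hlim₁ : Tendsto ρ (comap Real.toEReal (𝓝[>] y₁)) atTop)
    (hlim₂ : Tendsto ρ (comap Real.toEReal (𝓝[<] y₂)) atTop)
    (h : MapsTo (surfaceParam ρ) (strip y₁ y₂) space) : IsProperMap h.restrict := by
  have hopen : IsOpen space := isOpen_lt (by fun_prop) continuous_const
  have : LocallyCompactSpace space := hopen.locallyCompactSpace
  have hcont : Continuous h.restrict := hc.mapsToRestrict h
  refine isProperMap_iff_isCompact_preimage.2 ⟨hcont, fun K hK => ?_⟩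
  have hX : Continuous fun p : space => horoHeight p :=
    continuousOn_iff_continuous_domRestrict.1 continuousOn_horoHeight
  have ht : Continuous fun p : space => horoTranslation p :=
    continuousOn_iff_continuous_domRestrict.1 continuousOn_horoTranslation
  obtain ⟨R, hR⟩ := hK.exists_bound_of_continuousOn hX.continuousOn
  obtain ⟨T, hT⟩ := hK.exists_bound_of_continuousOn ht.continuousOn
  obtain ⟨B, hB, hBs, hmem⟩ := exists_box_of_isCompact hy hlim₁ hlim₂ R T
  have hB' : IsCompact ((Subtype.val : strip y₁ y₂ → Fin 2 → ℝ) ⁻¹' B) :=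
    (IsInducing.subtypeVal.isCompact_preimage_iff (by simpa using hBs)).2 hB
  refine hB'.of_isClosed_subset (hK.isClosed.preimage hcont) fun q hq => ?_
  have h1 := hR _ hq
  have h2 := hT _ hq
  simp only [MapsTo.val_restrict_apply, surfaceParam_eq,
    horoHeight_halfSpaceParam (Real.exp_pos _), horoTranslation_halfSpaceParam (Real.exp_pos _),
    Real.norm_eq_abs, Real.abs_exp] at h1 h2
  refine hmem _ q.2 ?_ h2
  -- `R` bounds `exp ρ`, hence also `ρ`.
  linarith [Real.add_one_le_exp (ρ (q.1 0))]

theorem injective_fderiv_surfaceParam (hρ : DifferentiableOn ℝ ρ (openInterval y₁ y₂))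
    (hρ' : DifferentiableOn ℝ (deriv ρ) (openInterval y₁ y₂)) {q : Fin 2 → ℝ}
    (hq : q ∈ strip y₁ y₂) : Function.Injective (fderiv ℝ (surfaceParam ρ) q) := by
  rw [injective_iff_map_eq_zero]
  intro v hv
  have hsum : v = v 0 • Pi.single 0 1 + v 1 • Pi.single 1 1 := by
    ext i
    fin_cases i <;> simp
  have e0 : fderiv ℝ (surfaceParam ρ) q (Pi.single 0 1) = surfaceDeriv₀ ρ q :=
    partialDeriv_surfaceParam_zero_eqOn hρ hρ' hq
  have e1 : fderiv ℝ (surfaceParam ρ) q (Pi.single 1 1) = surfaceDeriv₁ ρ q :=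
    partialDeriv_surfaceParam_one_eqOn hρ hρ' hq
  rw [hsum, map_add, map_smul, map_smul, e0, e1] at hv
  have h0 : v 0 = 0 := by simpa [surfaceDeriv₀, surfaceDeriv₁] using congrFun hv 2
  have h1 : v 1 = 0 := by
    by_contra hne
    have a0 : chartIm (1 + Real.exp (ρ (q 0))) (q 1) = 0 := by
      simpa [surfaceDeriv₀, surfaceDeriv₁, h0, hne] using congrFun hv 0
    have a1 : chartRe (1 + Real.exp (ρ (q 0))) (q 1) = 0 := by
      simpa [surfaceDeriv₀, surfaceDeriv₁, h0, hne] using congrFun hv 1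
    -- With slope `0` the third entry of the conormal vanishes, so what remains is that the chart
    -- derivative is nonzero.
    refine conormal_ne_zero (Real.exp_pos (ρ (q 0))) (q 1) 0 ?_
    simp [conormal, a0, a1]
  rw [hsum, h0, h1, zero_smul, zero_smul, add_zero]

theorem isProperlyEmbedded_surfaceParam (hy : y₁ < y₂)
    (hρ : DifferentiableOn ℝ ρ (openInterval y₁ y₂))
    (hρ' : DifferentiableOn ℝ (deriv ρ) (openInterval y₁ y₂))
    (hlim₁ : Tendsto ρ (comap Real.toEReal (𝓝[>] y₁)) atTop)
    (hlim₂ : Tendsto ρ (comap Real.toEReal (𝓝[<] y₂)) atTop) :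
    IsProperlyEmbedded (strip y₁ y₂) (surfaceParam ρ) where
  contDiffOn := contDiffOn_one_surfaceParam hρ hρ'
  twiceDifferentiable a := by
    fin_cases a
    · exact DifferentiableOn.congr (fun q hq => (differentiableAt_surfaceDeriv₀
        (differentiableAt_of_mem_strip hρ hq)
        (differentiableAt_of_mem_strip hρ' hq)).differentiableWithinAt)
        (partialDeriv_surfaceParam_zero_eqOn hρ hρ')
    · exact DifferentiableOn.congr (fun q hq => (differentiableAt_surfaceDeriv₁
        (differentiableAt_of_mem_strip hρ hq)).differentiableWithinAt)
        (partialDeriv_surfaceParam_one_eqOn hρ hρ')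
  immersion q hq := injective_fderiv_surfaceParam hρ hρ' hq
  proper_embedding := by
    have h : MapsTo (surfaceParam ρ) (strip y₁ y₂) space := fun q _ => surfaceParam_mem_space ρ q
    have hp := isProperMap_restrict_surfaceParam hy
      (contDiffOn_one_surfaceParam hρ hρ').continuousOn hlim₁ hlim₂ h
    refine ⟨h, (IsClosedEmbedding.of_continuous_injective_isClosedMap hp.continuous ?_
      hp.isClosedMap).isEmbedding, hp⟩
    exact (MapsTo.restrict_inj h).2 (injective_surfaceParam ρ).injOn

/-! ### The point at infinity -/

theorem asymptoticBoundary_surface (hy : y₁ < y₂)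
    (hρ : ContinuousOn ρ (openInterval y₁ y₂))
    (hlim₁ : Tendsto ρ (comap Real.toEReal (𝓝[>] y₁)) atTop)
    (hlim₂ : Tendsto ρ (comap Real.toEReal (𝓝[<] y₂)) atTop) :
    asymptoticBoundary (proj '' surface y₁ y₂ ρ) = {![1, 0]} := by
  obtain ⟨c, hc⟩ := exists_lower_bound hy hρ hlim₁ hlim₂
  -- The horoball `X ≥ exp c` with denominators cleared. It is closed in the whole plane, and on the
  -- unit circle its right-hand side is `0`, forcing `z = (1, 0)`.
  have hhoro : proj '' surface y₁ y₂ ρ ⊆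
      {z : Fin 2 → ℝ | Real.exp c * ((z 0 - 1) ^ 2 + z 1 ^ 2) ≤ 1 - (z 0 ^ 2 + z 1 ^ 2)} := by
    rintro _ ⟨_, ⟨q, hq, rfl⟩, rfl⟩
    have hX := Real.exp_pos (ρ (q 0))
    have h1 := sub_one_normSq_halfSpaceParam hX (q 1) (q 0)
    have h2 := one_sub_normSq_halfSpaceParam hX (q 1) (q 0)
    simp only [mem_ofPred_eq, proj, surfaceParam_eq, Matrix.cons_val]
    rw [h1, h2, mul_div_assoc', mul_comm]
    gcongr
    exact hc _ hq
  have hclosed : IsClosed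
      {z : Fin 2 → ℝ | Real.exp c * ((z 0 - 1) ^ 2 + z 1 ^ 2) ≤ 1 - (z 0 ^ 2 + z 1 ^ 2)} :=
    isClosed_le (by fun_prop) (by fun_prop)
  refine Subset.antisymm ?_ ?_
  · rintro z ⟨hz, hz1⟩
    have h1 := closure_minimal hhoro hclosed hz
    simp only [mem_ofPred_eq] at h1
    rw [show z 0 ^ 2 + z 1 ^ 2 = 1 from hz1] at h1
    have h2 : (z 0 - 1) ^ 2 + z 1 ^ 2 ≤ 0 := by
      nlinarith [Real.exp_pos c, sq_nonneg (z 0 - 1), sq_nonneg (z 1)]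
    have h3 : z 0 - 1 = 0 := by
      rw [← sq_eq_zero_iff]; linarith [sq_nonneg (z 0 - 1), sq_nonneg (z 1), h2]
    have h4 : z 1 = 0 := by
      rw [← sq_eq_zero_iff]; linarith [sq_nonneg (z 0 - 1), sq_nonneg (z 1), h2]
    ext i
    fin_cases i
    · simpa using sub_eq_zero.1 h3
    · simpa using h4
  · rw [singleton_subset_iff]
    refine ⟨?_, by simp [circleAtInfinity]⟩
    obtain ⟨y, hy1, hy2⟩ := EReal.lt_iff_exists_real_btwn.1 hy
    -- A single horocycle, followed as `t → ∞`, already converges to `(1, 0)`.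
    refine mem_closure_of_tendsto (f := fun t : ℝ => proj (surfaceParam ρ ![y, t])) (b := atTop) ?_
      (Eventually.of_forall fun t => mem_image_of_mem _ (mem_image_of_mem _ ⟨hy1, hy2⟩))
    simp only [surfaceParam_eq, proj, halfSpaceParam, Matrix.cons_val]
    have hX : 0 < 1 + Real.exp (ρ y) := by positivity
    generalize 1 + Real.exp (ρ y) = W at hX
    have hsq : Tendsto (fun t : ℝ => W ^ 2 + t ^ 2) atTop atTop :=
      tendsto_atTop_add_const_left _ _ (tendsto_pow_atTop two_ne_zero)
    rw [tendsto_pi_nhds]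
    intro i
    fin_cases i
    · simpa using (hsq.const_div_atTop (2 * W)).const_sub 1
    · have hb : Tendsto (fun t : ℝ => 2 / t) atTop (𝓝 0) := tendsto_id.const_div_atTop 2
      refine squeeze_zero' (g := fun t : ℝ => 2 / t) ?_ ?_ hb
      · filter_upwards [eventually_gt_atTop 0] with t ht
        simp only [Fin.mk_one, Matrix.cons_val]
        positivity
      · filter_upwards [eventually_gt_atTop 0] with t ht
        simp only [Fin.mk_one, Matrix.cons_val]
        rw [div_le_div_iff₀ (by positivity) ht]
        nlinarith [sq_nonneg W]

/-! ### Vertical planes -/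

/-- A geodesic is the intersection of the disk with a single real algebraic curve. -/
theorem mem_geodesic_iff {θ₁ θ₂ : Fin 2 → ℝ} (h₁ : θ₁ ∈ circleAtInfinity)
    (h₂ : θ₂ ∈ circleAtInfinity) (hne : θ₁ ≠ θ₂) {z : Fin 2 → ℝ} :
    z ∈ geodesic θ₁ θ₂ ↔ z ∈ disk ∧
      (θ₁ 0 * θ₂ 1 - θ₁ 1 * θ₂ 0) * (z 0 ^ 2 + z 1 ^ 2 + 1) =
        2 * (z 0 * (θ₂ 1 - θ₁ 1) + z 1 * (θ₁ 0 - θ₂ 0)) := by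
  have e₁ : θ₁ 0 ^ 2 + θ₁ 1 ^ 2 = 1 := h₁
  have e₂ : θ₂ 0 ^ 2 + θ₂ 1 ^ 2 = 1 := h₂
  refine and_congr_right fun _ => ⟨?_, fun h => ?_⟩
  · rintro (⟨c, c₁, c₂, cz⟩ | ⟨v, hv, v₁, v₂, vz⟩)
    · simp only [OnOrthogonalCircle] at c₁ c₂ cz
      -- Orthogonality puts `c` on the tangents at `θ₁` and `θ₂`; eliminating `c` by Cramer's rule
      -- leaves the stated curve.
      have d₁ : θ₁ 0 * c 0 + θ₁ 1 * c 1 = 1 := by linarith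
      have d₂ : θ₂ 0 * c 0 + θ₂ 1 * c 1 = 1 := by linarith
      have dz : z 0 ^ 2 + z 1 ^ 2 + 1 = 2 * (z 0 * c 0 + z 1 * c 1) := by linarith
      rw [dz]
      linear_combination 2 * z 0 * (θ₂ 1 * d₁ - θ₁ 1 * d₂) + 2 * z 1 * (θ₁ 0 * d₂ - θ₂ 0 * d₁)
    · simp only [OnDiameter] at v₁ v₂ vz
      have key : ∀ a b : Fin 2 → ℝ, v 0 * a 0 + v 1 * a 1 = 0 → v 0 * b 0 + v 1 * b 1 = 0 →
          a 0 * b 1 - a 1 * b 0 = 0 := by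
        intro a b ha hb
        by_contra hab
        refine hv ?_
        ext i
        fin_cases i
        · refine (mul_eq_zero.1 (?_ : (a 0 * b 1 - a 1 * b 0) * v 0 = 0)).resolve_left hab
          linear_combination b 1 * ha - a 1 * hb
        · refine (mul_eq_zero.1 (?_ : (a 0 * b 1 - a 1 * b 0) * v 1 = 0)).resolve_left hab
          linear_combination a 0 * hb - b 0 * ha
      rw [key _ _ v₁ v₂]
      linear_combination 2 * key _ _ vz v₁ - 2 * key _ _ vz v₂
  -- The cross product vanishes exactly for antipodal endpoints, when the geodesic is a diameter;
  -- otherwise dividing by it gives the centre.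
  · by_cases hα : θ₁ 0 * θ₂ 1 - θ₁ 1 * θ₂ 0 = 0
    · refine Or.inr ⟨![θ₂ 1 - θ₁ 1, θ₁ 0 - θ₂ 0], fun h0 => hne ?_, ?_, ?_, ?_⟩
      · have a0 : θ₂ 1 - θ₁ 1 = 0 := congrFun h0 0
        have a1 : θ₁ 0 - θ₂ 0 = 0 := congrFun h0 1
        ext i
        fin_cases i
        · exact sub_eq_zero.1 a1
        · exact (sub_eq_zero.1 a0).symm
      · simp only [OnDiameter, Matrix.cons_val]
        linear_combination hα
      · simp only [OnDiameter, Matrix.cons_val]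
        linear_combination hα
      · rw [hα] at h
        simp only [OnDiameter, Matrix.cons_val]
        linear_combination -h / 2
    · have key : ∀ a : Fin 2 → ℝ, (θ₁ 0 * θ₂ 1 - θ₁ 1 * θ₂ 0) * (a 0 ^ 2 + a 1 ^ 2 + 1) =
          2 * (a 0 * (θ₂ 1 - θ₁ 1) + a 1 * (θ₁ 0 - θ₂ 0)) →
          OnOrthogonalCircle ![(θ₂ 1 - θ₁ 1) / (θ₁ 0 * θ₂ 1 - θ₁ 1 * θ₂ 0),
            (θ₁ 0 - θ₂ 0) / (θ₁ 0 * θ₂ 1 - θ₁ 1 * θ₂ 0)] a := by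
        intro a ha
        have ha' : a 0 ^ 2 + a 1 ^ 2 + 1 = 2 * (a 0 * (θ₂ 1 - θ₁ 1) + a 1 * (θ₁ 0 - θ₂ 0)) /
            (θ₁ 0 * θ₂ 1 - θ₁ 1 * θ₂ 0) := by
          rw [eq_div_iff hα, mul_comm, ha]
        simp only [OnOrthogonalCircle, Matrix.cons_val]
        linear_combination ha'
      refine Or.inl ⟨_, key θ₁ ?_, key θ₂ ?_, key z h⟩
      · linear_combination (θ₁ 0 * θ₂ 1 - θ₁ 1 * θ₂ 0) * e₁
      · linear_combination (θ₁ 0 * θ₂ 1 - θ₁ 1 * θ₂ 0) * e₂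

/-- A chord with endpoints different from `(1, 0)` does not pass through `(1, 0)`. -/
theorem cross_sub_ne_zero {θ₁ θ₂ : Fin 2 → ℝ} (h₁ : θ₁ ∈ circleAtInfinity \ {![1, 0]})
    (h₂ : θ₂ ∈ circleAtInfinity \ {![1, 0]}) (hne : θ₁ ≠ θ₂) :
    θ₁ 0 * θ₂ 1 - θ₁ 1 * θ₂ 0 - (θ₂ 1 - θ₁ 1) ≠ 0 := by
  have aux : ∀ θ ∈ circleAtInfinity \ {![1, 0]}, θ 0 - 1 ≠ 0 := by
    rintro θ ⟨h, h'⟩ h0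
    have e : θ 0 ^ 2 + θ 1 ^ 2 = 1 := h
    have e0 : θ 0 = 1 := sub_eq_zero.1 h0
    have e1 : θ 1 = 0 := by
      rw [e0] at e
      exact sq_eq_zero_iff.1 (by linarith)
    refine h' ?_
    rw [mem_singleton_iff]
    ext i
    fin_cases i
    · exact e0
    · exact e1
  have e₁ : θ₁ 0 ^ 2 + θ₁ 1 ^ 2 = 1 := h₁.1
  have e₂ : θ₂ 0 ^ 2 + θ₂ 1 ^ 2 = 1 := h₂.1
  have u₁ := aux _ h₁
  have u₂ := aux _ h₂
  intro h
  have hx : θ₁ 0 = θ₂ 0 := by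
    -- `h` says that `θ₁ - (1, 0)` and `θ₂ - (1, 0)` are parallel. Squaring this and replacing each
    -- `θ 1 ^ 2` by `1 - θ 0 ^ 2` gives the factorization.
    have : (θ₁ 0 - 1) * (θ₂ 0 - 1) * (θ₁ 0 - θ₂ 0) = 0 := by
      linear_combination (1 / 2) * (θ₁ 0 - 1) ^ 2 * e₂ - (1 / 2) * (θ₂ 0 - 1) ^ 2 * e₁
        - (1 / 2) * ((θ₁ 0 - 1) * θ₂ 1 + θ₁ 1 * (θ₂ 0 - 1)) * h
    exact sub_eq_zero.1 ((mul_eq_zero.1 this).resolve_left (mul_ne_zero u₁ u₂))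
  have hy : θ₁ 1 = θ₂ 1 := by
    have : (θ₂ 0 - 1) * (θ₁ 1 - θ₂ 1) = 0 := by
      rw [hx] at h
      linear_combination -h
    exact sub_eq_zero.1 ((mul_eq_zero.1 this).resolve_left u₂)
  refine hne ?_
  ext i
  fin_cases i
  · exact hx
  · exact hy

/-- In the upper half-space model, the geodesic with endpoints `θ₁, θ₂` is a half circle. -/
theorem surfaceParam_mem_verticalPlane_iff {θ₁ θ₂ : Fin 2 → ℝ} (h₁ : θ₁ ∈ circleAtInfinity)
    (h₂ : θ₂ ∈ circleAtInfinity) (hne : θ₁ ≠ θ₂) (q : Fin 2 → ℝ) :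
    surfaceParam ρ q ∈ verticalPlane θ₁ θ₂ ↔
      (θ₁ 0 * θ₂ 1 - θ₁ 1 * θ₂ 0 - (θ₂ 1 - θ₁ 1)) * (Real.exp (ρ (q 0)) ^ 2 + q 1 ^ 2) =
        2 * (θ₁ 0 - θ₂ 0) * q 1 - (θ₁ 0 * θ₂ 1 - θ₁ 1 * θ₂ 0 + (θ₂ 1 - θ₁ 1)) := by
  have hX := Real.exp_pos (ρ (q 0))
  have hdisk : proj (surfaceParam ρ q) ∈ disk := surfaceParam_mem_space ρ q
  rw [verticalPlane, mem_ofPred_eq, mem_geodesic_iff h₁ h₂ hne, and_iff_right hdisk]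
  have h2 := one_sub_normSq_halfSpaceParam hX (q 1) (q 0)
  simp only [proj, surfaceParam_eq, Matrix.cons_val]
  rw [show halfSpaceParam (Real.exp (ρ (q 0))) (q 1) (q 0) 0 ^ 2 +
    halfSpaceParam (Real.exp (ρ (q 0))) (q 1) (q 0) 1 ^ 2 + 1 =
    2 - 4 * Real.exp (ρ (q 0)) / ((1 + Real.exp (ρ (q 0))) ^ 2 + q 1 ^ 2) by linarith]
  simp only [halfSpaceParam, Matrix.cons_val]
  generalize Real.exp (ρ (q 0)) = X at *
  have hD : (1 + X) ^ 2 + q 1 ^ 2 ≠ 0 := by positivity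
  have hfac : ∀ α β w : ℝ, α * (2 - 4 * X / ((1 + X) ^ 2 + q 1 ^ 2)) -
      2 * ((1 - 2 * (1 + X) / ((1 + X) ^ 2 + q 1 ^ 2)) * β +
        2 * q 1 / ((1 + X) ^ 2 + q 1 ^ 2) * w) = 2 / ((1 + X) ^ 2 + q 1 ^ 2) *
      ((α - β) * (X ^ 2 + q 1 ^ 2) - (2 * w * q 1 - (α + β))) := by
    intro α β w
    field_simp
    ring
  rw [← sub_eq_zero, hfac, mul_eq_zero, or_iff_right (div_ne_zero two_ne_zero hD), sub_eq_zero]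

theorem isCompact_verticalPlane_inter_surface (hy : y₁ < y₂)
    (hρ : ContinuousOn ρ (openInterval y₁ y₂))
    (hc : ContinuousOn (surfaceParam ρ) (strip y₁ y₂))
    (hlim₁ : Tendsto ρ (comap Real.toEReal (𝓝[>] y₁)) atTop)
    (hlim₂ : Tendsto ρ (comap Real.toEReal (𝓝[<] y₂)) atTop) {θ₁ θ₂ : Fin 2 → ℝ}
    (h₁ : θ₁ ∈ circleAtInfinity \ {![1, 0]}) (h₂ : θ₂ ∈ circleAtInfinity \ {![1, 0]})
    (hne : θ₁ ≠ θ₂) : IsCompact (verticalPlane θ₁ θ₂ ∩ surface y₁ y₂ ρ) := by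
  have hk := cross_sub_ne_zero h₁ h₂ hne
  have hiff := surfaceParam_mem_verticalPlane_iff (ρ := ρ) h₁.1 h₂.1 hne
  set k := θ₁ 0 * θ₂ 1 - θ₁ 1 * θ₂ 0 - (θ₂ 1 - θ₁ 1)
  set m := θ₁ 0 * θ₂ 1 - θ₁ 1 * θ₂ 0 + (θ₂ 1 - θ₁ 1)
  set w := θ₁ 0 - θ₂ 0
  clear_value k m w
  -- Completing the square: since `k ≠ 0`, this is a circle centred at `(0, w / k)`, and `r` below
  -- is its squared radius.
  have hbound : ∀ X t : ℝ, k * (X ^ 2 + t ^ 2) = 2 * w * t - m →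
      X ^ 2 + (t - w / k) ^ 2 = (w / k) ^ 2 - m / k := by
    intro X t h
    field_simp
    linear_combination k * h
  set r := (w / k) ^ 2 - m / k
  -- From `|s| ≤ 1 + s²`, both `X` and `|t - w / k|` are at most `1 + r`.
  obtain ⟨B, hB, hBs, hmem⟩ := exists_box_of_isCompact hy hlim₁ hlim₂ (1 + r) (1 + r + |w / k|)
  set P := B ∩ {q | k * (Real.exp (ρ (q 0)) ^ 2 + q 1 ^ 2) = 2 * w * q 1 - m} with hP
  have hPc : IsCompact P := by
    refine hB.of_isClosed_subset ?_ inter_subset_left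
    have hρB : ContinuousOn (fun q : Fin 2 → ℝ => ρ (q 0)) B :=
      hρ.comp (continuous_apply 0).continuousOn hBs
    have : ContinuousOn (fun q : Fin 2 → ℝ =>
        k * (Real.exp (ρ (q 0)) ^ 2 + q 1 ^ 2) - (2 * w * q 1 - m)) B :=
      (continuousOn_const.mul ((hρB.rexp.pow 2).add (by fun_prop))).sub (by fun_prop)
    -- Continuity of `ρ` is known only on the interval, so closedness is obtained relative to the
    -- closed box `B`.
    have hcl := this.preimage_isClosed_of_isClosed hB.isClosed (isClosed_singleton (x := (0 : ℝ)))
    simpa only [hP, preimage, mem_singleton_iff, sub_eq_zero] using hcl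
  have himage : verticalPlane θ₁ θ₂ ∩ surface y₁ y₂ ρ = surfaceParam ρ '' P := by
    refine Subset.antisymm ?_ ?_
    · rintro _ ⟨hv, q, hq, rfl⟩
      have e := (hiff q).1 hv
      have hb := hbound _ _ e
      refine ⟨q, ⟨hmem q hq ?_ ?_, e⟩, rfl⟩
      · nlinarith [Real.add_one_le_exp (ρ (q 0)), sq_nonneg (q 1 - w / k),
          sq_nonneg (Real.exp (ρ (q 0)) - 1)]
      · have h1 : |q 1 - w / k| ≤ 1 + r := by
          nlinarith [sq_abs (q 1 - w / k), sq_nonneg (|q 1 - w / k| - 1),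
            sq_nonneg (Real.exp (ρ (q 0)))]
        have h3 := abs_add_le (q 1 - w / k) (w / k)
        rw [sub_add_cancel] at h3
        linarith
    · rintro _ ⟨q, ⟨hqB, e⟩, rfl⟩
      exact ⟨(hiff q).2 e, q, hBs hqB, rfl⟩
  rw [himage]
  exact hPc.image_of_continuousOn (hc.mono (inter_subset_left.trans hBs))

end Surface

end H2xR

theorem proposition4p1 (y₁ y₂ : EReal) (hy : y₁ < y₂) (ρ : ℝ → ℝ)
    (hρ : DifferentiableOn ℝ ρ (H2xR.openInterval y₁ y₂))
    (hρ' : DifferentiableOn ℝ (deriv ρ) (H2xR.openInterval y₁ y₂))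
    (hconv : ∀ y ∈ H2xR.openInterval y₁ y₂, 0 < deriv (deriv ρ) y)
    (hlim₁ : Tendsto ρ (comap Real.toEReal (𝓝[>] y₁)) atTop)
    (hlim₂ : Tendsto ρ (comap Real.toEReal (𝓝[<] y₂)) atTop) :
    H2xR.IsProperlyEmbedded (H2xR.strip y₁ y₂) (H2xR.surfaceParam ρ) ∧
    (∀ n : WithTop ℕ∞, ContDiffOn ℝ n ρ (H2xR.openInterval y₁ y₂) →
      ContDiffOn ℝ n (H2xR.surfaceParam ρ) (H2xR.strip y₁ y₂)) ∧
    (∀ q ∈ H2xR.strip y₁ y₂,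
      H2xR.extrinsicCurvature H2xR.metric (H2xR.surfaceParam ρ) q =
        deriv (deriv ρ) (q 0) / (1 + deriv ρ (q 0) ^ 2) ^ 2) ∧
    (∀ q ∈ H2xR.strip y₁ y₂,
      0 < H2xR.extrinsicCurvature H2xR.metric (H2xR.surfaceParam ρ) q) ∧
    H2xR.HasSimpleEnd (H2xR.surface y₁ y₂ ρ) := by
  have hc := H2xR.contDiffOn_one_surfaceParam hρ hρ'
  refine ⟨H2xR.isProperlyEmbedded_surfaceParam hy hρ hρ' hlim₁ hlim₂,
    fun n hn => H2xR.contDiffOn_surfaceParam hn,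
    fun q hq => H2xR.extrinsicCurvature_surfaceParam hρ hρ' hq, fun q hq => ?_, ![1, 0],
    by simp [H2xR.circleAtInfinity],
    H2xR.asymptoticBoundary_surface hy hρ.continuousOn hlim₁ hlim₂,
    -- The empty set is compact, so the second alternative covers every case.
    fun θ₁ h₁ θ₂ h₂ hne => Or.inr (H2xR.isCompact_verticalPlane_inter_surface hy
      hρ.continuousOn hc.continuousOn hlim₁ hlim₂ h₁ h₂ hne)⟩
  rw [H2xR.extrinsicCurvature_surfaceParam hρ hρ' hq]
  have := hconv (q 0) hq
  positivity
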